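/- Consider $n$ units with fixed real potential outcomes $Y_i(1), Y_i(0)$ and effects $\tau_i = Y_i(1)-Y_i(0)$, $1\le i\le n$. Let $\tau_{(1)}\le\dots\le\tau_{(n)}$ be the sorted effects of all units. The assignment $Z\in\{0,1\}^n$ comes from a completely randomized experiment: for fixed $n_1, n_0\ge 1$ with $n_1+n_0=n$, $Z$ is uniform on the vectors with exactly $n_1$ ones, and it is independent of the potential missingness indicators $(M_i(1),M_i(0))_{i\le n}$. Outcomes are missing at random: the pairs $(M_i(1),M_i(0))$ are i.i.d. on $\{0,1\}^2$ with probabilities $p_{mm'}$ that do not depend on the potential outcomes. Let $M_i = Z_iM_i(1)+(1-Z_i)M_i(0)$ and $\mathcal S=\{i: M_i=1\}$ (the units with observed outcomes), and let $\tau_{\mathrm o(1)}\le\dots\le\tau_{\mathrm o(|\mathcal S|)}$ be the sorted effects of the units in $\mathcal S$. Let $0<\alpha<1/2$, and let $\mathcal I_{\mathrm o,k}$, $1\le k\le|\mathcal S|$, be random intervals, each of the form $(c,\infty)$ or $[c,\infty)$ (with $c=-\infty$, i.e. $\mathbb R$, allowed); put $\mathcal I_{\mathrm o,0}=\mathbb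 R$. Let $J\ge1$ and $1\le k_1<\dots<k_J\le n$. For each possible size $m\in\{0,\dots,n\}$ of $\mathcal S$, let $0\le k'_1(m)\le\dots\le k'_J(m)\le m$ be integers, and write $$\Delta_{\mathrm H}(m)=\mathbb P\Big(\bigcup_{j=1}^J\Big\{\sum_{i=j}^J\mathfrak H_i>m-k'_j(m)\Big\}\Big),$$ where $(m-\sum_{j=1}^J\mathfrak H_j,\mathfrak H_1,\dots,\mathfrak H_J)$ has the multivariate hypergeometric distribution $\mathrm{MHG}(k_1,k_2-k_1,\dots,k_J-k_{J-1},n-k_J;m)$, i.e. the law of the numbers of balls of the $J+1$ colours in a simple random sample of $m$ balls from an urn with $k_1,k_2-k_1,\dots,k_J-k_{J-1},n-k_J$ balls of the respective colours. Then: 1. For every $m$ with $\mathbb P(|\mathcal S|=m)>0$ and every $A\subseteq\{1,\dots,n\}$ with $|A|=m$, $\mathbb P(\mathcal S=A\mid|\mathcal S|=m)=\binom nm^{-1}$; that is, given its size, $\mathcal S$ is a simple random sample of all units. 2. Every $\mathcal I_{\mathrm o,k'_j(|\mathcal S|)}$ is of the form $(c,\infty)$ or $[c,\infty)$ with $c\in[-\infty,\infty)$.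 3. For every $m$ with $\mathbb P(|\mathcal S|=m)>0$: if, conditionally on $|\mathcal S|=m$, the $\mathcal I_{\mathrm o,k}$ are $1-2\alpha$ simultaneous prediction intervals for the $\tau_{\mathrm o(k)}$, i.e. $\mathbb P(\tau_{\mathrm o(k)}\in\mathcal I_{\mathrm o,k}\ \forall\,1\le k\le|\mathcal S| \mid |\mathcal S|=m)\ge1-2\alpha$, then $$\mathbb P\big(\tau_{(k_j)}\in\mathcal I_{\mathrm o,k'_j(m)}\ \forall\,1\le j\le J\ \big|\ |\mathcal S|=m\big)\ge1-2\alpha-\Delta_{\mathrm H}(m).$$ 4. If the $\mathcal I_{\mathrm o,k}$ are unconditionally $1-2\alpha$ simultaneous prediction intervals, i.e. $\mathbb P(\tau_{\mathrm o(k)}\in\mathcal I_{\mathrm o,k}\ \forall\,1\le k\le|\mathcal S|)\ge1-2\alpha$, then $$\mathbb P\big(\tau_{(k_j)}\in\mathcal I_{\mathrm o,k'_j(|\mathcal S|)}\ \forall\,1\le j\le J\big)\ge1-2\alpha-\mathbb E\big[\Delta_{\mathrm H}(|\mathcal S|)\big].$$ -/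

import Mathlib

open MeasureTheory ProbabilityTheory

noncomputable section

namespace Attrition

/-- Completely randomized experiment on `n` units with `n₁` treated units: `Z` is uniform on the
assignments with exactly `n₁` treated units, and it is independent of the potential missingness
indicators `(M(1), M(0))`. The potential outcomes are constants, so conditioning on them is void. -/
structure IsCRE {Ω : Type*} [MeasurableSpace Ω] (P : Measure Ω) {n : ℕ} (n₁ : ℕ)
    (Z M₁ M₀ : Ω → Fin n → Bool) : Prop where
  law : ∀ z : Fin n → Bool, P.real {ω | Z ω = z} =
    if (Finset.univ.filter (fun i => z i = true)).card = n₁ then 1 / (n.choose n₁ : ℝ) else 0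
  indep : IndepFun Z (fun ω => (M₁ ω, M₀ ω)) P

/-- Missing at random: the pairs `(M_i(1), M_i(0))` are i.i.d. with probability mass `p (m, m')`
at `(m, m')`. -/
structure IsMAR {Ω : Type*} [MeasurableSpace Ω] (P : Measure Ω) {n : ℕ}
    (M₁ M₀ : Ω → Fin n → Bool) (p : Bool × Bool → ℝ) : Prop where
  nonneg : ∀ c, 0 ≤ p c
  sum_eq_one : ∑ c, p c = 1
  indep : iIndepFun (fun (i : Fin n) (ω : Ω) => (M₁ ω i, M₀ ω i)) P
  law : ∀ (i : Fin n) (c : Bool × Bool), P.real {ω | (M₁ ω i, M₀ ω i) = c} = p c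

/-- The realized indicator `M_i = Z_i M_i(1) + (1 - Z_i) M_i(0)`; the value `true` means that the
outcome of the unit is observed. -/
def realizedM {Ω : Type*} {n : ℕ} (Z M₁ M₀ : Ω → Fin n → Bool) (ω : Ω) (i : Fin n) : Bool :=
  if Z ω i = true then M₁ ω i else M₀ ω i

/-- The set `S = {i : M_i = 1}` of units with observed outcomes. -/
def observedSet {Ω : Type*} {n : ℕ} (Z M₁ M₀ : Ω → Fin n → Bool) (ω : Ω) : Finset (Fin n) :=
  Finset.univ.filter (fun i => realizedM Z M₁ M₀ ω i = true)

/-- Individual treatment effects `τ_i = Y_i(1) - Y_i(0)`. -/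
def effect {n : ℕ} (Y₁ Y₀ : Fin n → ℝ) (i : Fin n) : ℝ := Y₁ i - Y₀ i

/-- The `k`-th smallest value (with multiplicity) of `τ` over the units in `A`, where
`1 ≤ k ≤ A.card`; the default value outside this range is never used. -/
def sortedEffect {n : ℕ} (τ : Fin n → ℝ) (A : Finset (Fin n)) (k : ℕ) : ℝ :=
  ((A.val.map τ).sort (· ≤ ·)).getD (k - 1) 0

/-- One-sided intervals `(c, ∞)` or `[c, ∞)`, where `c = -∞` (the real line) is allowed. -/
def IsLowerBoundInterval (I : Set ℝ) : Prop :=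
  I = Set.univ ∨ ∃ c : ℝ, I = Set.Ioi c ∨ I = Set.Ici c

/-- A family of intervals indexed by `k ≥ 1`, extended to `k = 0` by the real line. -/
def extendZero (I : ℕ → Set ℝ) (k : ℕ) : Set ℝ := if k = 0 then Set.univ else I k

/-- Probability mass at `h` of the multivariate hypergeometric distribution `MHG(K; m)`: the
probability that a simple random sample of `m` balls, from an urn with `K i` balls of colour `i`,
has exactly `h i` balls of each colour `i`. -/
def mhgMass {r : ℕ} (K : Fin r → ℕ) (m : ℕ) (h : Fin r → ℕ) : ℝ :=
  if ∑ i, h i = m then (∏ i, ((K i).choose (h i) : ℝ)) / ((∑ i, K i).choose m : ℝ) else 0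

/-- Probability of the event `E` under `MHG(K; m)`, which lives on the `h` with `h i ≤ K i`. -/
def mhgProb {r : ℕ} (K : Fin r → ℕ) (m : ℕ) (E : Set (Fin r → ℕ)) : ℝ :=
  open Classical in
  ∑ h ∈ (Fintype.piFinset (fun i => Finset.range (K i + 1))).filter (fun h => h ∈ E),
    mhgMass K m h

/-- The cut points `0, k_1, …, k_J, n`. -/
def cutPoint {J : ℕ} (n : ℕ) (k : Fin J → ℕ) : Fin (J + 2) → ℕ :=
  Fin.snoc (α := fun _ => ℕ) (Fin.cons (α := fun _ => ℕ) 0 k) n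

/-- The colour sizes `k_1, k_2 - k_1, …, k_J - k_{J-1}, n - k_J`. -/
def urnSizes {J : ℕ} (n : ℕ) (k : Fin J → ℕ) (i : Fin (J + 1)) : ℕ :=
  cutPoint n k i.succ - cutPoint n k i.castSucc

/-- `Δ_H(k'; n, m, k) = P(⋃_j {∑_{i ≥ j} H_i > m - k'_j})`, where `(H_0, H_1, …, H_J)`, with
`H_0 = m - ∑_{i ≥ 1} H_i`, follows `MHG(k_1, k_2 - k_1, …, k_J - k_{J-1}, n - k_J; m)`. The index
`j : Fin J` counts from `0`, so the sum starts at the colour `j.succ`. -/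
def deltaH {J : ℕ} (k' : Fin J → ℕ) (n m : ℕ) (k : Fin J → ℕ) : ℝ :=
  mhgProb (urnSizes n k) m
    {h | ∃ j : Fin J, (m : ℤ) - (k' j : ℤ) < ∑ i ∈ Finset.Ici j.succ, (h i : ℤ)}

/-- The event that `I_k` contains the `k`-th smallest effect among the units in `S`,
simultaneously for all `1 ≤ k ≤ |S|`. -/
def predictionEvent {Ω : Type*} {n : ℕ} (τ : Fin n → ℝ) (S : Ω → Finset (Fin n))
    (I : Ω → ℕ → Set ℝ) : Set Ω :=
  {ω | ∀ l : ℕ, 1 ≤ l → l ≤ (S ω).card → sortedEffect τ (S ω) l ∈ I ω l}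

/-- The event that `I_{k'_j}` contains the effect quantile `τ_(k_j)` among all units,
simultaneously for all `j`; here `k'` is chosen as a function of the size of `S`. -/
def coverageEvent {Ω : Type*} {n J : ℕ} (τ : Fin n → ℝ) (S : Ω → Finset (Fin n))
    (I : Ω → ℕ → Set ℝ) (k : Fin J → ℕ) (k' : ℕ → Fin J → ℕ) : Set Ω :=
  {ω | ∀ j : Fin J, sortedEffect τ Finset.univ (k j) ∈ extendZero (I ω) (k' (S ω).card j)}

end Attrition

end

/-!
The assignment and the pairs of missingness indicators are independent and each has a law that is
invariant under relabelling the units, so the set of observed units is exchangeable, that is, a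
simple random sample given its size `m`. If the sample contains at least `k' j` of the `k j` units
with the smallest effects, then its `k' j`-th smallest effect is at most the `k j`-th smallest
effect of all units, and an interval unbounded above that contains the former contains the latter.
The prediction event is therefore covered by the coverage event and the event that some `j` violates
this condition. Colouring the units by the blocks into which the cut points `k j` divide their ranks
turns the violation into an event about the colour counts of a simple random sample, whose
probability is `Δ_H`.
-/

open Finset

namespace Attrition

section Urn

variable {ι κ : Type*} [DecidableEq κ]

/-- The number of balls of colour `i` in the sample `A`, when the ball `a` has colour `c a`. -/
def colourCount (c : ι → κ) (A : Finset ι) (i : κ) : ℕ := #{a ∈ A | c a = i}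

theorem colourCount_mono (c : ι → κ) : Monotone (colourCount c) :=
  fun _ _ h _ => card_le_card (filter_subset_filter _ h)

theorem sum_colourCount [Fintype κ] (c : ι → κ) (A : Finset ι) : ∑ i, colourCount c A i = #A :=
  (card_eq_sum_card_fiberwise fun _ _ => mem_coe.2 (mem_univ _)).symm

variable [Fintype ι]

theorem card_filter_colourCount_eq [Fintype κ] (c : ι → κ) (h : κ → ℕ) :
    #{A | colourCount c A = h} = ∏ i, (colourCount c univ i).choose (h i) := by
  classical
  have hprod : ∏ i, (colourCount c univ i).choose (h i) =
      #(Fintype.piFinset fun i => powersetCard (h i) {a | c a = i}) := by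
    simp only [Fintype.card_piFinset, card_powersetCard, colourCount]
  have hfilter {F : κ → Finset ι}
      (hF : F ∈ Fintype.piFinset fun i => powersetCard (h i) {a | c a = i}) (i : κ) :
      {a ∈ ({a | a ∈ F (c a)} : Finset ι) | c a = i} = F i := by
    have hFi := (mem_powersetCard.1 (Fintype.mem_piFinset.1 hF i)).1
    ext a
    have hFia : a ∈ F i → a ∈ ({a | c a = i} : Finset ι) := fun ha => hFi ha
    grind
  rw [hprod]
  refine card_nbij' (fun A i => {a ∈ A | c a = i}) (fun F => ({a | a ∈ F (c a)} : Finset ι))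
    (fun A hA => ?_) (fun F hF => ?_) (fun A _ => by ext; simp) (fun F hF => funext (hfilter hF))
  · exact Fintype.mem_piFinset.2 fun i => mem_powersetCard.2
      ⟨filter_subset_filter _ (subset_univ A), congrFun (mem_filter.1 hA).2 i⟩
  · refine mem_filter.2 ⟨mem_univ _, funext fun i => ?_⟩
    rw [colourCount, hfilter hF]
    exact (mem_powersetCard.1 (Fintype.mem_piFinset.1 hF i)).2

theorem mhgMass_colourCount_univ {r : ℕ} (c : ι → Fin r) (m : ℕ) (h : Fin r → ℕ) :
    mhgMass (colourCount c univ) m h =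
      #{A ∈ powersetCard m univ | colourCount c A = h} / ((Fintype.card ι).choose m : ℝ) := by
  rw [mhgMass, sum_colourCount, card_univ]
  split_ifs with hm
  · have hfilter : ({A ∈ powersetCard m univ | colourCount c A = h} : Finset (Finset ι)) =
        ({A | colourCount c A = h} : Finset (Finset ι)) := by
      ext A
      simp only [mem_filter, mem_powersetCard_univ, mem_univ, true_and, and_iff_right_iff_imp]
      rintro rfl
      exact (sum_colourCount c A).symm.trans hm
    rw [hfilter, card_filter_colourCount_eq, Nat.cast_prod]
  · rw [filter_eq_empty_iff.2, card_empty, Nat.cast_zero, zero_div]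
    rintro A hA rfl
    exact hm ((sum_colourCount c A).trans (mem_powersetCard_univ.1 hA))

theorem mhgProb_colourCount_univ {r : ℕ} (c : ι → Fin r) (m : ℕ) (E : Set (Fin r → ℕ))
    [DecidablePred (· ∈ E)] :
    mhgProb (colourCount c univ) m E =
      #{A ∈ powersetCard m univ | colourCount c A ∈ E} / ((Fintype.card ι).choose m : ℝ) := by
  classical
  have hmaps : ∀ A ∈ ({A ∈ powersetCard m univ | colourCount c A ∈ E} : Finset (Finset ι)),
      colourCount c A ∈ ({h ∈ Fintype.piFinset fun i => range (colourCount c univ i + 1) | h ∈ E} :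
        Finset (Fin r → ℕ)) := by
    intro A hA
    refine mem_filter.2 ⟨Fintype.mem_piFinset.2 fun i => ?_, (mem_filter.1 hA).2⟩
    exact mem_range_succ_iff.2 (colourCount_mono c (subset_univ A) i)
  rw [mhgProb, card_eq_sum_card_fiberwise hmaps, Nat.cast_sum, sum_div]
  refine sum_congr (by congr) fun h hh => ?_
  rw [mhgMass_colourCount_univ, filter_filter]
  congr 3
  refine filter_congr fun A _ => ?_
  have hE : h ∈ E := (mem_filter.1 hh).2
  grind

end Urn

section RankColour

variable {J n : ℕ} {k : Fin J → ℕ}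

/-- The colour `0, …, J` of the ball of rank `r`, when the cut points `k j` split the balls, ranked
from `0` on, into the `J + 1` blocks of the urn. -/
def rankColour (k : Fin J → ℕ) (r : ℕ) : Fin (J + 1) :=
  ⟨#{j | k j ≤ r}, Nat.lt_succ_of_le (card_finset_fin_le _)⟩

theorem succ_le_rankColour (hk : Monotone k) {r : ℕ} {j : Fin J} :
    j.succ ≤ rankColour k r ↔ k j ≤ r :=
  Tuple.lt_card_le_iff_apply_le_of_monotone hk

theorem cutPoint_le (hkn : ∀ j, k j ≤ n) (i : Fin (J + 2)) : cutPoint n k i ≤ n := by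
  refine Fin.lastCases ?_ (Fin.cases ?_ fun j => ?_) i
  · simp [cutPoint]
  · simp [cutPoint, -Fin.castSucc_zero]
  · simpa [cutPoint, -Fin.castSucc_succ] using hkn j

theorem cutPoint_le_iff (hk : Monotone k) {r : ℕ} (hr : r < n) (i : Fin (J + 2)) :
    cutPoint n k i ≤ r ↔ (i : ℕ) ≤ rankColour k r := by
  refine Fin.lastCases ?_ (Fin.cases ?_ fun j => ?_) i
  · simpa [cutPoint, hr.not_ge] using Nat.lt_succ_iff.1 (rankColour k r).isLt
  · simp [cutPoint, -Fin.castSucc_zero]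
  · simpa [cutPoint, -Fin.castSucc_succ, Fin.le_def] using (succ_le_rankColour hk (r := r)).symm

theorem rankColour_eq_iff (hk : Monotone k) {r : ℕ} (hr : r < n) (i : Fin (J + 1)) :
    rankColour k r = i ↔ r ∈ Ico (cutPoint n k i.castSucc) (cutPoint n k i.succ) := by
  rw [mem_Ico, ← not_le, cutPoint_le_iff hk hr, cutPoint_le_iff hk hr, Fin.ext_iff,
    Fin.val_castSucc, Fin.val_succ]
  omega

theorem colourCount_rankColour_univ (hk : Monotone k) (hkn : ∀ j, k j ≤ n)
    (ρ : Equiv.Perm (Fin n)) :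
    colourCount (fun a => rankColour k (ρ a)) univ = urnSizes n k := by
  funext i
  rw [urnSizes, ← Nat.card_Ico]
  refine card_nbij (fun a => ρ a) ?_ (fun a _ b _ hab => ρ.injective (Fin.ext hab)) ?_
  · intro a ha
    exact (rankColour_eq_iff hk (ρ a).isLt i).1 (mem_filter.1 ha).2
  · intro r hr
    have hrn : r < n := (mem_Ico.1 hr).2.trans_le (cutPoint_le hkn _)
    exact ⟨ρ.symm ⟨r, hrn⟩, by simpa using (rankColour_eq_iff hk hrn i).2 hr, by simp⟩

theorem sum_colourCount_rankColour (hk : Monotone k) (ρ : Fin n → ℕ) (A : Finset (Fin n))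
    (j : Fin J) :
    ∑ i ∈ Ici j.succ, colourCount (fun a => rankColour k (ρ a)) A i = #{a ∈ A | k j ≤ ρ a} := by
  rw [card_eq_sum_card_fiberwise (f := fun a => rankColour k (ρ a)) (t := Ici j.succ)]
  · refine sum_congr rfl fun i hi => ?_
    rw [filter_filter]
    refine congrArg card (filter_congr fun a _ => ?_)
    simp only [← succ_le_rankColour hk]
    grind
  · intro a ha
    simpa [succ_le_rankColour hk] using (mem_filter.1 ha).2

/-- The samples of size `m` that contain, for some `j`, fewer than `l j` of the `k j` units of
lowest rank, where the unit `a` has rank `ρ a`, counted from `0`. These are the samples for which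
the `l j`-th smallest sampled effect may exceed the `k j`-th smallest effect of all units. -/
def topHeavySamples (ρ : Equiv.Perm (Fin n)) (k l : Fin J → ℕ) (m : ℕ) : Finset (Finset (Fin n)) :=
  {A ∈ powersetCard m univ | ∃ j, #{a ∈ A | ρ a < k j} < l j}

theorem topHeavySamples_subset (ρ : Equiv.Perm (Fin n)) (k l : Fin J → ℕ) (m : ℕ) :
    topHeavySamples ρ k l m ⊆ powersetCard m univ :=
  filter_subset _ _

theorem deltaH_eq_card_topHeavySamples_div (ρ : Equiv.Perm (Fin n)) (hk : Monotone k)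
    (hkn : ∀ j, k j ≤ n) (l : Fin J → ℕ) (m : ℕ) :
    deltaH l n m k = #(topHeavySamples ρ k l m) / (n.choose m : ℝ) := by
  classical
  rw [deltaH, ← colourCount_rankColour_univ hk hkn ρ, mhgProb_colourCount_univ, Fintype.card_fin,
    topHeavySamples]
  congr 3
  refine filter_congr fun A hA => exists_congr fun j => ?_
  have hcount : ∑ i ∈ Ici j.succ, (colourCount (fun a => rankColour k (ρ a)) A i : ℤ) =
      #{a ∈ A | k j ≤ ρ a} :=
    mod_cast sum_colourCount_rankColour hk (fun a => ρ a) A j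
  have hsplit := card_filter_add_card_filter_not (s := A) (fun a => ρ a < k j)
  simp only [not_lt, (mem_powersetCard.1 hA).2] at hsplit
  rw [hcount]
  omega

end RankColour

section SortedEffects

theorem card_filter_get_le {α : Type*} [Preorder α] [DecidableLE α] (L : List α) (x : α) :
    #{i | L.get i ≤ x} = L.countP (· ≤ x) := by
  have hmap : univ.val.map L.get = (L : Multiset α) := by rw [Fin.univ_val_map, List.ofFn_get]
  rw [← Multiset.coe_countP, ← hmap, Multiset.countP_map]
  rfl

variable {n : ℕ} {τ : Fin n → ℝ}

theorem sortedEffect_le_iff {A : Finset (Fin n)} {l : ℕ} (hl : 1 ≤ l) (hlA : l ≤ #A) {x : ℝ} :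
    sortedEffect τ A l ≤ x ↔ l ≤ #{a ∈ A | τ a ≤ x} := by
  set L := (A.val.map τ).sort (· ≤ ·) with hL
  have hlt : l - 1 < L.length := by
    rw [hL, Multiset.length_sort, Multiset.card_map, card_val]
    omega
  have hcount : L.countP (· ≤ x) = #{a ∈ A | τ a ≤ x} := by
    rw [← Multiset.coe_countP, hL, Multiset.sort_eq, Multiset.countP_map]
    rfl
  have hmono : Monotone L.get := (Multiset.pairwise_sort _ _).sortedLE.monotone_get
  rw [sortedEffect, List.getD_eq_getElem _ _ hlt, ← hcount, ← card_filter_get_le]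
  exact (Tuple.lt_card_le_iff_apply_le_of_monotone hmono (j := ⟨l - 1, hlt⟩)).symm.trans
    (by simp only; omega)

theorem sortedEffect_le_sortedEffect_univ {A : Finset (Fin n)} {l l' : ℕ} (hl : 1 ≤ l)
    (hln : l ≤ n) (hl' : 1 ≤ l') (h : l' ≤ #{a ∈ A | ((Tuple.sort τ).symm a : ℕ) < l}) :
    sortedEffect τ A l' ≤ sortedEffect τ univ l := by
  have hcard : l ≤ #{a | τ a ≤ sortedEffect τ univ l} :=
    (sortedEffect_le_iff hl (by simpa using hln)).1 le_rfl
  have hlow : ∀ a, ((Tuple.sort τ).symm a : ℕ) < l → τ a ≤ sortedEffect τ univ l := by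
    intro a ha
    have hsort : #{i | (τ ∘ Tuple.sort τ) i ≤ sortedEffect τ univ l} =
        #{a | τ a ≤ sortedEffect τ univ l} := card_equiv (Tuple.sort τ) (by simp)
    simpa using (Tuple.lt_card_le_iff_apply_le_of_monotone (Tuple.monotone_sort τ)).1
      ((ha.trans_le hcard).trans_eq hsort.symm)
  have hle : l' ≤ #{a ∈ A | τ a ≤ sortedEffect τ univ l} :=
    h.trans (card_le_card (monotone_filter_right A fun a _ => hlow a))
  exact (sortedEffect_le_iff hl' (hle.trans (card_filter_le _ _))).2 hle

theorem IsLowerBoundInterval.isUpperSet {I : Set ℝ} (hI : IsLowerBoundInterval I) :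
    IsUpperSet I := by
  rcases hI with rfl | ⟨c, rfl | rfl⟩
  exacts [isUpperSet_univ, isUpperSet_Ioi c, isUpperSet_Ici c]

theorem isLowerBoundInterval_extendZero {I : ℕ → Set ℝ} {m l : ℕ}
    (hI : ∀ i, 1 ≤ i → i ≤ m → IsLowerBoundInterval (I i)) (hl : l ≤ m) :
    IsLowerBoundInterval (extendZero I l) := by
  rw [extendZero]
  split_ifs with h0
  · exact Or.inl rfl
  · exact hI l (Nat.one_le_iff_ne_zero.2 h0) hl

variable {Ω : Type*} {S : Ω → Finset (Fin n)} {J : ℕ} {k : Fin J → ℕ} {k' : ℕ → Fin J → ℕ}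

/-- The event that the sample `S` is top-heavy for the thresholds `k'` belonging to its size. -/
def topHeavyEvent (ρ : Equiv.Perm (Fin n)) (S : Ω → Finset (Fin n)) (k : Fin J → ℕ)
    (k' : ℕ → Fin J → ℕ) : Set Ω :=
  {ω | S ω ∈ topHeavySamples ρ k (k' #(S ω)) #(S ω)}

theorem predictionEvent_subset_coverageEvent_union {I : Ω → ℕ → Set ℝ}
    (hI : ∀ ω l, 1 ≤ l → l ≤ #(S ω) → IsLowerBoundInterval (I ω l))
    (hk1 : ∀ j, 1 ≤ k j) (hkn : ∀ j, k j ≤ n) (hk'm : ∀ m ≤ n, ∀ j, k' m j ≤ m) :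
    predictionEvent τ S I ⊆
      coverageEvent τ S I k k' ∪ topHeavyEvent (Tuple.sort τ).symm S k k' := by
  refine fun ω hpred => or_iff_not_imp_right.2 fun hω (j : Fin J) => ?_
  have hle : k' #(S ω) j ≤ #(S ω) := hk'm _ (card_finset_fin_le _) j
  rw [extendZero]
  split_ifs with h0
  · trivial
  · have h1 : 1 ≤ k' #(S ω) j := Nat.one_le_iff_ne_zero.2 h0
    refine (hI ω _ h1 hle).isUpperSet
      (sortedEffect_le_sortedEffect_univ (hk1 j) (hkn j) h1 ?_) (hpred _ h1 hle)
    by_contra! hlt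
    have htop : S ω ∈ topHeavySamples (Tuple.sort τ).symm k (k' #(S ω)) #(S ω) :=
      mem_filter.2 ⟨mem_powersetCard_univ.2 rfl, j, hlt⟩
    exact hω htop

end SortedEffects

section Exchangeable

variable {Ω ι : Type*} [MeasurableSpace Ω] {P : Measure Ω} {S : Ω → Finset ι}

/-- A random subset of `ι` is exchangeable if all subsets of the same size are equally likely,
equivalently if its law is invariant under the permutations of `ι`. -/
structure IsExchangeable (P : Measure Ω) (S : Ω → Finset ι) : Prop where
  measurable : Measurable S
  measure_eq_of_card_eq : ∀ A B : Finset ι, #A = #B → P {ω | S ω = A} = P {ω | S ω = B}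

theorem isExchangeable_of_identDistrib_map [Finite ι] (hS : Measurable S)
    (hperm : ∀ π : Equiv.Perm ι, IdentDistrib S (fun ω => (S ω).map π.toEmbedding) P P) :
    IsExchangeable P S := by
  classical
  refine ⟨hS, fun A B hAB => ?_⟩
  obtain ⟨π, hπ⟩ : ∃ π : Equiv.Perm ι, A.map π.toEmbedding = B := by
    obtain ⟨π, hπ⟩ := Set.powersetCard.isPretransitive.exists_smul_eq
      (⟨A, hAB⟩ : Set.powersetCard ι #B) ⟨B, rfl⟩
    exact ⟨π, (map_eq_image _ A).trans (congrArg Subtype.val hπ)⟩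
  have hlaw := (hperm π).measure_mem_eq (measurableSet_singleton B)
  subst hπ
  simpa [Set.preimage, Finset.map_inj] using hlaw.symm

theorem IsExchangeable.measurableSet_card_eq [Finite ι] (hS : IsExchangeable P S) (m : ℕ) :
    MeasurableSet {ω | #(S ω) = m} :=
  hS.measurable (Set.toFinite {A | #A = m}).measurableSet

variable [Fintype ι] [IsFiniteMeasure P]

theorem IsExchangeable.measureReal_card_eq (hS : IsExchangeable P S) (A : Finset ι) :
    P.real {ω | #(S ω) = #A} = (Fintype.card ι).choose #A * P.real {ω | S ω = A} := by
  have hsum := sum_measureReal_preimage_singleton (μ := P) (powersetCard #A univ)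
    fun B _ => hS.measurable (measurableSet_singleton B)
  have hconst : ∀ B ∈ powersetCard #A univ, P.real (S ⁻¹' {B}) = P.real {ω | S ω = A} :=
    fun B hB => congrArg ENNReal.toReal
      (hS.measure_eq_of_card_eq B A (mem_powersetCard_univ.1 hB))
  rw [sum_congr rfl hconst, sum_const, card_powersetCard, card_univ, nsmul_eq_mul] at hsum
  rw [hsum]
  congr 1
  ext ω
  simp

theorem IsExchangeable.measureReal_mem_eq (hS : IsExchangeable P S) {m : ℕ}
    {𝒜 : Finset (Finset ι)} (h𝒜 : 𝒜 ⊆ powersetCard m univ) :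
    P.real {ω | S ω ∈ 𝒜} =
      P.real {ω | #(S ω) = m} * (#𝒜 / ((Fintype.card ι).choose m : ℝ)) := by
  have hconst : ∀ A ∈ 𝒜, P.real (S ⁻¹' {A}) =
      P.real {ω | #(S ω) = m} / ((Fintype.card ι).choose m : ℝ) := by
    intro A hA
    obtain rfl := mem_powersetCard_univ.1 (h𝒜 hA)
    have hpos : ((Fintype.card ι).choose #A : ℝ) ≠ 0 :=
      mod_cast (Nat.choose_pos (card_le_univ A)).ne'
    rw [hS.measureReal_card_eq, mul_div_cancel_left₀ _ hpos]
    rfl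
  have hsum := sum_measureReal_preimage_singleton (μ := P) 𝒜
    fun B _ => hS.measurable (measurableSet_singleton B)
  rw [sum_congr rfl hconst, sum_const, nsmul_eq_mul] at hsum
  rw [mul_div_left_comm]
  exact hsum.symm

theorem IsExchangeable.cond_real_mem_eq (hS : IsExchangeable P S) {m : ℕ}
    (hm : P {ω | #(S ω) = m} ≠ 0) {𝒜 : Finset (Finset ι)} (h𝒜 : 𝒜 ⊆ powersetCard m univ) :
    (P[|{ω | #(S ω) = m}]).real {ω | S ω ∈ 𝒜} = #𝒜 / ((Fintype.card ι).choose m : ℝ) := by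
  have hsub : {ω | S ω ∈ 𝒜} ⊆ {ω | #(S ω) = m} := fun ω hω => mem_powersetCard_univ.1 (h𝒜 hω)
  rw [measureReal_def, cond_apply (hS.measurableSet_card_eq m), Set.inter_eq_right.2 hsub,
    ENNReal.toReal_mul, ENNReal.toReal_inv, ← measureReal_def, ← measureReal_def,
    hS.measureReal_mem_eq h𝒜,
    inv_mul_cancel_left₀ (measureReal_ne_zero_iff (measure_ne_top _ _) |>.2 hm)]

end Exchangeable

section TopHeavy

variable {Ω : Type*} [MeasurableSpace Ω] {P : Measure Ω} [IsFiniteMeasure P] {n J : ℕ}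
  {S : Ω → Finset (Fin n)} {k : Fin J → ℕ}

theorem IsExchangeable.cond_real_topHeavyEvent (hS : IsExchangeable P S) (hk : Monotone k)
    (hkn : ∀ j, k j ≤ n) (ρ : Equiv.Perm (Fin n)) (k' : ℕ → Fin J → ℕ) {m : ℕ}
    (hm : P {ω | #(S ω) = m} ≠ 0) :
    (P[|{ω | #(S ω) = m}]).real (topHeavyEvent ρ S k k') = deltaH (k' m) n m k := by
  have hcongr : topHeavyEvent ρ S k k' =ᵐ[P[|{ω | #(S ω) = m}]]
      {ω | S ω ∈ topHeavySamples ρ k (k' m) m} := by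
    filter_upwards [ae_cond_mem (hS.measurableSet_card_eq m)] with ω hω
    obtain rfl : #(S ω) = m := hω
    rfl
  rw [measureReal_congr hcongr, hS.cond_real_mem_eq hm (topHeavySamples_subset ρ k _ m),
    Fintype.card_fin, deltaH_eq_card_topHeavySamples_div ρ hk hkn]

theorem IsExchangeable.measureReal_topHeavyEvent (hS : IsExchangeable P S) (hk : Monotone k)
    (hkn : ∀ j, k j ≤ n) (ρ : Equiv.Perm (Fin n)) (k' : ℕ → Fin J → ℕ) :
    P.real (topHeavyEvent ρ S k k') =
      ∑ m ∈ range (n + 1), P.real {ω | #(S ω) = m} * deltaH (k' m) n m k := by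
  have hcard (m : ℕ) (ω : Ω) (hω : S ω ∈ topHeavySamples ρ k (k' m) m) : #(S ω) = m :=
    mem_powersetCard_univ.1 (topHeavySamples_subset ρ k _ m hω)
  have hsize (m : ℕ) : P.real {ω | S ω ∈ topHeavySamples ρ k (k' m) m} =
      P.real {ω | #(S ω) = m} * deltaH (k' m) n m k := by
    rw [hS.measureReal_mem_eq (topHeavySamples_subset ρ k _ m), Fintype.card_fin,
      deltaH_eq_card_topHeavySamples_div ρ hk hkn]
  have hunion : topHeavyEvent ρ S k k' =
      ⋃ m ∈ range (n + 1), {ω | S ω ∈ topHeavySamples ρ k (k' m) m} := by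
    ext ω
    simp only [Set.mem_iUnion₂, mem_range_succ_iff]
    refine ⟨fun hω => ⟨#(S ω), card_finset_fin_le _, hω⟩, ?_⟩
    rintro ⟨m, -, hω⟩
    obtain rfl := hcard m ω hω
    exact hω
  rw [hunion, measureReal_biUnion_finset]
  · exact sum_congr rfl fun m _ => hsize m
  · exact fun m _ m' _ hne => Set.disjoint_left.2 fun ω hω hω' =>
      hne ((hcard m ω hω).symm.trans (hcard m' ω hω'))
  · exact fun m _ => hS.measurable (Set.toFinite _).measurableSet

end TopHeavy

section MissingAtRandom

variable {Ω : Type*} [MeasurableSpace Ω] {P : Measure Ω} {n n₁ : ℕ} {Z M₁ M₀ : Ω → Fin n → Bool}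
  {p : Bool × Bool → ℝ}

theorem identDistrib_of_measureReal_eq [IsFiniteMeasure P] {α : Type*} [MeasurableSpace α]
    [MeasurableSingletonClass α] [Countable α] {X Y : Ω → α} (hX : Measurable X)
    (hY : Measurable Y) (h : ∀ a, P.real {ω | X ω = a} = P.real {ω | Y ω = a}) :
    IdentDistrib X Y P P where
  aemeasurable_fst := hX.aemeasurable
  aemeasurable_snd := hY.aemeasurable
  map_eq := by
    refine Measure.ext_of_measureReal_singleton fun a => ?_
    rw [map_measureReal_apply hX (measurableSet_singleton a),
      map_measureReal_apply hY (measurableSet_singleton a)]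
    exact h a

theorem IsCRE.identDistrib_comp_perm [IsFiniteMeasure P] (hCRE : IsCRE P n₁ Z M₁ M₀)
    (hZ : Measurable Z) (π : Equiv.Perm (Fin n)) :
    IdentDistrib Z (fun ω => Z ω ∘ π) P P := by
  refine identDistrib_of_measureReal_eq hZ (by fun_prop) fun z => ?_
  have hpre : {ω | Z ω ∘ π = z} = {ω | Z ω = z ∘ π.symm} := by
    simp only [Equiv.eq_comp_symm]
  have hcard : #{i | (z ∘ π.symm) i = true} = #{i | z i = true} :=
    card_equiv π.symm (by simp)
  rw [hpre, hCRE.law, hCRE.law, hcard]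

theorem IsMAR.identDistrib_comp_perm [IsFiniteMeasure P] (hMAR : IsMAR P M₁ M₀ p)
    (hM₁ : Measurable M₁) (hM₀ : Measurable M₀) (π : Equiv.Perm (Fin n)) :
    IdentDistrib (fun ω i => (M₁ ω i, M₀ ω i)) (fun ω i => (M₁ ω (π i), M₀ ω (π i))) P P :=
  IdentDistrib.pi
    (fun i => identDistrib_of_measureReal_eq (by fun_prop) (by fun_prop) fun c =>
      (hMAR.law i c).trans (hMAR.law (π i) c).symm)
    hMAR.indep (hMAR.indep.precomp π.injective)

theorem isExchangeable_observedSet [IsFiniteMeasure P] (hCRE : IsCRE P n₁ Z M₁ M₀)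
    (hMAR : IsMAR P M₁ M₀ p) (hZ : Measurable Z) (hM₁ : Measurable M₁) (hM₀ : Measurable M₀) :
    IsExchangeable P (observedSet Z M₁ M₀) := by
  let G : (Fin n → Bool) × (Fin n → Bool × Bool) → Finset (Fin n) :=
    fun x => {i | (if x.1 i = true then (x.2 i).1 else (x.2 i).2) = true}
  have hG : Measurable G := .of_discrete
  refine isExchangeable_of_identDistrib_map (hG.comp (by fun_prop : Measurable
    fun ω => (Z ω, fun i => (M₁ ω i, M₀ ω i)))) fun π => ?_
  have hindep : IndepFun Z (fun ω i => (M₁ ω i, M₀ ω i)) P :=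
    hCRE.indep.comp (φ := id)
      (ψ := fun (x : (Fin n → Bool) × (Fin n → Bool)) i => (x.1 i, x.2 i))
      measurable_id (by fun_prop)
  have hindep_perm : IndepFun (fun ω => Z ω ∘ π.symm)
      (fun ω i => (M₁ ω (π.symm i), M₀ ω (π.symm i))) P :=
    hindep.comp (φ := fun z : Fin n → Bool => z ∘ π.symm)
      (ψ := fun (x : Fin n → Bool × Bool) i => x (π.symm i)) (by fun_prop) (by fun_prop)
  have hlaw := ((hCRE.identDistrib_comp_perm hZ π.symm).prodMk
    (hMAR.identDistrib_comp_perm hM₁ hM₀ π.symm) hindep hindep_perm).comp hG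
  have hmap : (fun ω => (observedSet Z M₁ M₀ ω).map π.toEmbedding) =
      G ∘ fun ω => (Z ω ∘ π.symm, fun i => (M₁ ω (π.symm i), M₀ ω (π.symm i))) := by
    ext ω i
    simp [G, observedSet, realizedM, mem_map_equiv]
  rw [hmap]
  exact hlaw

end MissingAtRandom

end Attrition

open Attrition in
theorem mainTheorem8_general {Ω : Type*} [MeasurableSpace Ω] (P : Measure Ω) [IsFiniteMeasure P]
    {n : ℕ} {S : Ω → Finset (Fin n)} (hS : IsExchangeable P S) (τ : Fin n → ℝ) (γ : ℝ)
    {I : Ω → ℕ → Set ℝ} (hI : ∀ ω l, 1 ≤ l → l ≤ #(S ω) → IsLowerBoundInterval (I ω l))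
    {J : ℕ} {k : Fin J → ℕ} (hk : Monotone k) (hk1 : ∀ j, 1 ≤ k j) (hkn : ∀ j, k j ≤ n)
    {k' : ℕ → Fin J → ℕ} (hk'm : ∀ m ≤ n, ∀ j, k' m j ≤ m) :
    (∀ m : ℕ, P {ω | #(S ω) = m} ≠ 0 → ∀ A : Finset (Fin n), #A = m →
      (P[|{ω | #(S ω) = m}]).real {ω | S ω = A} = 1 / (n.choose m : ℝ)) ∧
    (∀ ω j, IsLowerBoundInterval (extendZero (I ω) (k' #(S ω) j))) ∧
    (∀ m : ℕ, P {ω | #(S ω) = m} ≠ 0 →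
      γ ≤ (P[|{ω | #(S ω) = m}]).real (predictionEvent τ S I) →
      γ - deltaH (k' m) n m k ≤ (P[|{ω | #(S ω) = m}]).real (coverageEvent τ S I k k')) ∧
    (γ ≤ P.real (predictionEvent τ S I) →
      γ - ∑ m ∈ range (n + 1), P.real {ω | #(S ω) = m} * deltaH (k' m) n m k ≤
        P.real (coverageEvent τ S I k k')) := by
  have hunion (ν : Measure Ω) [IsFiniteMeasure ν] : ν.real (predictionEvent τ S I) ≤
      ν.real (coverageEvent τ S I k k') +
        ν.real (topHeavyEvent (Tuple.sort τ).symm S k k') :=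
    (measureReal_mono (predictionEvent_subset_coverageEvent_union hI hk1 hkn hk'm)).trans
      (measureReal_union_le _ _)
  refine ⟨fun m hm A hA => ?_, fun ω j => ?_, fun m hm hpred => ?_, fun hpred => ?_⟩
  · simpa using hS.cond_real_mem_eq hm (singleton_subset_iff.2 (mem_powersetCard_univ.2 hA))
  · exact isLowerBoundInterval_extendZero (hI ω) (hk'm _ (card_finset_fin_le _) j)
  · rw [← hS.cond_real_topHeavyEvent hk hkn (Tuple.sort τ).symm k' hm]
    linarith [hunion P[|{ω | #(S ω) = m}]]
  · rw [← hS.measureReal_topHeavyEvent hk hkn (Tuple.sort τ).symm k']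
    linarith [hunion P]

theorem mainTheorem8 {Ω : Type*} [MeasurableSpace Ω] (P : Measure Ω) [IsProbabilityMeasure P]
    (n n₁ : ℕ) (hn₁ : 0 < n₁) (hn₁n : n₁ < n)
    (Y₁ Y₀ : Fin n → ℝ)
    (Z M₁ M₀ : Ω → Fin n → Bool)
    (hZ : Measurable Z) (hM₁ : Measurable M₁) (hM₀ : Measurable M₀)
    (hCRE : Attrition.IsCRE P n₁ Z M₁ M₀)
    (p : Bool × Bool → ℝ) (hMAR : Attrition.IsMAR P M₁ M₀ p)
    (S : Ω → Finset (Fin n)) (hS : S = Attrition.observedSet Z M₁ M₀)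
    (τ : Fin n → ℝ) (hτ : τ = Attrition.effect Y₁ Y₀)
    (α : ℝ) (hα : 0 < α) (hα' : α < 1 / 2)
    (I : Ω → ℕ → Set ℝ)
    (hI : ∀ ω l, 1 ≤ l → l ≤ (S ω).card → Attrition.IsLowerBoundInterval (I ω l))
    (J : ℕ) (hJ : 1 ≤ J) (k : Fin J → ℕ) (hk : StrictMono k)
    (hk1 : ∀ j, 1 ≤ k j) (hkn : ∀ j, k j ≤ n)
    (k' : ℕ → Fin J → ℕ) (hk' : ∀ m ≤ n, Monotone (k' m)) (hk'm : ∀ m ≤ n, ∀ j, k' m j ≤ m) :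
    -- given its size, the observed set is a simple random sample of all units
    (∀ m : ℕ, P {ω | (S ω).card = m} ≠ 0 → ∀ A : Finset (Fin n), A.card = m →
      (P[|{ω | (S ω).card = m}]).real {ω | S ω = A} = 1 / (n.choose m : ℝ)) ∧
    -- the intervals are of the form `(c, ∞)` or `[c, ∞)`
    (∀ ω j, Attrition.IsLowerBoundInterval
      (Attrition.extendZero (I ω) (k' (S ω).card j))) ∧
    -- simultaneous coverage conditional on the size of the observed set
    (∀ m : ℕ, P {ω | (S ω).card = m} ≠ 0 →
      1 - 2 * α ≤ (P[|{ω | (S ω).card = m}]).real (Attrition.predictionEvent τ S I) →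
      1 - 2 * α - Attrition.deltaH (k' m) n m k ≤
        (P[|{ω | (S ω).card = m}]).real (Attrition.coverageEvent τ S I k k')) ∧
    -- simultaneous coverage averaged over the size of the observed set
    (1 - 2 * α ≤ P.real (Attrition.predictionEvent τ S I) →
      1 - 2 * α -
          ∑ m ∈ Finset.range (n + 1),
            P.real {ω | (S ω).card = m} * Attrition.deltaH (k' m) n m k ≤
        P.real (Attrition.coverageEvent τ S I k k')) := by
  subst hS
  exact mainTheorem8_general P (Attrition.isExchangeable_observedSet hCRE hMAR hZ hM₁ hM₀) τ _ hI
    hk.monotone hk1 hkn hk'm
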